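/- Let $L$ be any first-order language, $T$ an $L$-theory, and $\varphi(x,y)$ an $L$-formula, where $x,y$ are finite tuples of variables. A partitioned formula $\varphi(x,y)$ is NIP in $T$ if for every $M\models T$ there is some $n<\omega$ such that no subset of $M^x$ of size $n$ is shattered by the family $\{\varphi(M,a) : a\in M^y\}$. $T$ has definable Skolem functions if for every formula $\chi(x',y')$, with $x'$ and $y'$ finite tuples and $y'$ nonempty, there is a function $f$, definable in $T$ without parameters (by one formula for all models of $T$), such that $T\models\forall y'\,\big(\exists x'\,\chi(x',y')\to\chi(f(y'),y')\big)$. For $M\models T$ and $A\subseteq M^y$, let $S_\varphi(A)$ denote the set of complete $\varphi$-types over $A$. Suppose that $T$ has definable Skolem functions and that $\varphi(x,y)$ is NIP in $T$. Then there is a formula $\psi(y,z)$, where $z=(z_0,\dots,z_{k-1})$ is a tuple of copies of $y$, such that: 1. $\psi$ uniformly defines $\varphi$-types over finite sets: for every $M\models T$, every finite $A\subseteq M^y$ with $|A|\ge 2$ and every $p\in S_\varphi(A)$ there is $c\in A^k$ such that for all $b\in A$, $M\models\psi(b,c)$ if and only if $\varphi(x,b)\in p$; 2. $\psi(y,z)$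 is NIP in $T$; 3. $\psi$ is a majority vote of instances of $\varphi$: there are $m<\omega$ and functions $f_0,\dots,f_{m-1}$ from $z$ to $x$, definable in $T$ without parameters (each by one formula for all models of $T$), such that in every $M\models T$, for all $b\in M^y$ and $c\in (M^y)^k$, $$M\models\psi(b,c)\iff \big|\{t<m : M\models\varphi(f_t(c),b)\}\big|>\tfrac m2 ;$$ moreover, $\psi(y,z)$ is a Boolean combination of formulas expressing $\varphi(f_t(z),y)$, $t<m$. -/

import Mathlib

universe u v w

namespace UDTFS

/-! Conventions: a finite tuple of variables is given by a finite index type, and `M^x`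
is `α → M` when `x` is indexed by `α`.  A partitioned formula `φ(x, y)` is a formula with
variables indexed by `α ⊕ β`. Models are nonempty, and they range over a universe that is
large enough for the compactness and Löwenheim-Skolem theorems. -/

/-- The family `F` of subsets of `X` shatters `A`. -/
def Shatters {X : Type*} (F : Set (Set X)) (A : Set X) : Prop :=
  ∀ S ⊆ A, ∃ B ∈ F, B ∩ A = S

/-- `F` is a VC-class: for some `n`, no subset of `X` of size `n` is shattered by `F`. -/
def IsVCClass {X : Type*} (F : Set (Set X)) : Prop :=
  ∃ n : ℕ, ∀ A : Finset X, A.card = n → ¬ Shatters F (A : Set X)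

variable {L : FirstOrder.Language.{u, v}} {α β : Type}

/-- `M ⊨ φ(b, a)`. -/
def Holds {M : Type*} [L.Structure M] (φ : L.Formula (α ⊕ β)) (b : α → M) (a : β → M) : Prop :=
  φ.Realize (Sum.elim b a)

/-- The subset `φ(M, a)` of `M^x`. -/
def fiber {M : Type*} [L.Structure M] (φ : L.Formula (α ⊕ β)) (a : β → M) : Set (α → M) :=
  {b | Holds φ b a}

/-- `φ(x, y)` is NIP in `T`: for each `M ⊨ T`, the family of all `φ(M, a)`, `a ∈ M^y`, is a
VC-class. -/
def IsNIP (T : L.Theory) (φ : L.Formula (α ⊕ β)) : Prop :=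
  ∀ M : T.ModelType.{u, v, max u v w},
    IsVCClass (Set.range fun a : β → M => fiber φ a)

/-- `p` is a complete `φ`-type over `A ⊆ M^y`.  The pair `(a, true)` stands for the formula
`φ(x, a)` and `(a, false)` for `¬ φ(x, a)`.  Consistency with the elementary diagram of `M` is
finite satisfiability in `M`. -/
structure IsPhiType {M : Type*} [L.Structure M] (φ : L.Formula (α ⊕ β)) (A : Set (β → M))
    (p : Set ((β → M) × Bool)) : Prop where
  fst_mem : ∀ q ∈ p, q.1 ∈ A
  complete : ∀ a ∈ A, (a, true) ∈ p ∨ (a, false) ∈ p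
  consistent : ∀ p₀ ⊆ p, p₀.Finite → ∃ b : α → M, ∀ q ∈ p₀, (Holds φ b q.1 ↔ q.2 = true)

/-- `ψ(y, z)`, where `z` is a `k`-tuple of copies of `y`, uniformly defines `φ`-types over finite
sets: for all `M ⊨ T`, all finite `A ⊆ M^y` with at least two elements and all `p ∈ S_φ(A)`, there
is `c ∈ A^z` such that `ψ(b, c) ↔ φ(x, b) ∈ p` for all `b ∈ A`. -/
def UniformlyDefinesTypes (T : L.Theory) (φ : L.Formula (α ⊕ β)) {k : ℕ}
    (ψ : L.Formula (β ⊕ (Fin k × β))) : Prop :=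
  ∀ (M : T.ModelType.{u, v, max u v w}) (A : Set (β → M)), A.Finite → 2 ≤ A.ncard →
    ∀ p : Set ((β → M) × Bool), IsPhiType φ A p →
      ∃ c : Fin k → β → M, (∀ i, c i ∈ A) ∧
        ∀ b ∈ A, (Holds ψ b (Function.uncurry c) ↔ (b, true) ∈ p)

/-- In every model `M` of `T`, the formula `θ(y, x)` is the graph of a (total) function
`M^y → M^x`, which is thus definable without parameters. -/
def DefinesFunction (T : L.Theory) (θ : L.Formula (β ⊕ α)) : Prop :=
  ∀ (M : T.ModelType.{u, v, max u v w}) (a : β → M), ∃! b : α → M, Holds θ a b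

/-- `T` has definable Skolem functions: for every `χ(x, y)` there is a definable function `f` such
that `T ⊨ ∀ y, (∃ x, χ(x, y)) → χ(f(y), y)`.  Only nonempty parameter tuples `y` are considered,
which is the weaker of the two usual conventions. -/
def HasDefinableSkolemFunctions (T : L.Theory) : Prop :=
  ∀ (α β : Type) [Finite α] [Finite β] [Nonempty β] (χ : L.Formula (α ⊕ β)),
    ∃ θ : L.Formula (β ⊕ α), DefinesFunction.{u, v, w} T θ ∧
      ∀ (M : T.ModelType.{u, v, max u v w}) (a : β → M) (b : α → M),
        Holds θ a b → (∃ b' : α → M, Holds χ b' a) → Holds χ b a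

/-- Boolean combinations of members of `S` (`⊥` and `→` generate all Boolean connectives). -/
inductive IsBooleanCombination (S : Set (L.Formula α)) : L.Formula α → Prop
  | of (φ : L.Formula α) : φ ∈ S → IsBooleanCombination S φ
  | bot : IsBooleanCombination S ⊥
  | imp (φ ψ : L.Formula α) : IsBooleanCombination S φ → IsBooleanCombination S ψ →
      IsBooleanCombination S (φ.imp ψ)

end UDTFS

namespace UDTFS

open FirstOrder FirstOrder.Language

/-! A `φ`-type over a finite `A` is realized by some `x₀`, so it is a labelling of `A` by a member
of a class of finite VC dimension, and `ψ` is a definable form of the Moran–Yehudayoff compression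
scheme. A Skolem function gives a rule `H` that sends a labelled sample of `s` points of `A` to some
`x` with the same `φ`-labels on the sample. Classes of polynomial growth have approximations of
bounded size (`exists_approx_size`), so for every distribution on `A` there is a sample `Z` such
that `H Z` errs on mass at most 1/3. By minimax (`exists_mixed_strategy`) one distribution on
samples errs at each point of `A` with probability at most 1/3. Approximating it by `m` samples
keeps the error below 1/2, so the majority of the `H (Z t)` is right on all of `A`
(`exists_compression_size`).

The numbers `s` and `m` depend only on the growth of `φ`, which compactness bounds independently of
the model (`IsNIP.exists_uniform`). Labels are coded by equality or inequality of two parameters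
from `A`, hence the condition `|A| ≥ 2`. Finally, `ψ` is NIP because its trace on `n` points is
determined by `m` traces of `φ`, each chosen among polynomially many
(`PolyGrowth.exists_not_hasPattern_comb`). -/

/-- The sets `{i | R (b i) (a S)}` realize all subsets of an `n`-element index set. -/
def HasPattern {X : Type*} {Y : Type*} (R : X → Y → Prop) (n : ℕ) : Prop :=
  ∃ (b : Fin n → X) (a : Set (Fin n) → Y), ∀ i S, R (b i) (a S) ↔ i ∈ S

/-! ### Shattering, duality and the Sauer–Shelah bound -/

section Pattern

variable {X : Type*} {Y : Type*} {R : X → Y → Prop}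

theorem HasPattern.of_shatters {A : Finset X}
    (h : Shatters (Set.range fun a : Y => {b | R b a}) (A : Set X)) : HasPattern R A.card := by
  classical
  let e := A.equivFin.symm
  have key : ∀ S : Set (Fin A.card), ∃ a : Y, ∀ i, R (e i : X) a ↔ i ∈ S := by
    intro S
    obtain ⟨B, ⟨a, rfl⟩, hB⟩ := h ((fun i => (e i : X)) '' S) (by
      rintro _ ⟨i, -, rfl⟩
      exact (e i).2)
    refine ⟨a, fun i => ?_⟩
    have h1 : (e i : X) ∈ (fun i => (e i : X)) '' S ↔ i ∈ S :=
      (Subtype.val_injective.comp e.injective).mem_set_image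
    rw [← h1, ← hB]
    simp
  choose a ha using key
  exact ⟨fun i => e i, a, fun i S => ha S i⟩

theorem HasPattern.exists_shatters {n : ℕ} (h : HasPattern R n) :
    ∃ A : Finset X, A.card = n ∧
      Shatters (Set.range fun a : Y => {b | R b a}) (A : Set X) := by
  classical
  obtain ⟨b, a, hab⟩ := h
  have hb : Function.Injective b := by
    intro i j hij
    have h1 := hab i {j}
    rw [hij, hab j {j}] at h1
    simpa using h1
  refine ⟨Finset.univ.map ⟨b, hb⟩, by simp, fun S hS => ?_⟩
  refine ⟨_, ⟨a (b ⁻¹' S), rfl⟩, ?_⟩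
  ext x
  constructor
  · rintro ⟨h1, h2⟩
    obtain ⟨i, rfl⟩ : ∃ i, b i = x := by simpa using h2
    exact (hab i _).1 h1
  · intro hx
    have h2 := hS hx
    refine ⟨?_, h2⟩
    obtain ⟨i, rfl⟩ : ∃ i, b i = x := by simpa using h2
    exact (hab i _).2 hx

theorem isVCClass_iff_exists_not_hasPattern :
    IsVCClass (Set.range fun a : Y => {b | R b a}) ↔ ∃ n, ¬ HasPattern R n := by
  constructor
  · rintro ⟨n, hn⟩
    refine ⟨n, fun h => ?_⟩
    obtain ⟨A, hA, hs⟩ := h.exists_shatters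
    exact hn A hA hs
  · rintro ⟨n, hn⟩
    refine ⟨n, ?_⟩
    rintro A rfl hs
    exact hn (.of_shatters hs)

theorem HasPattern.mono {m n : ℕ} (hmn : m ≤ n) (h : HasPattern R n) : HasPattern R m := by
  obtain ⟨b, a, hab⟩ := h
  refine ⟨fun i => b (Fin.castLE hmn i), fun S => a (Fin.castLE hmn '' S), fun i S => ?_⟩
  rw [hab]
  exact (Fin.castLE_injective hmn).mem_set_image

/-- Index the `2 ^ n` points of the dual pattern by the subsets of `Fin n`; the element cutting out
the subsets that contain `i` serves as the `i`-th point. -/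
theorem HasPattern.of_swap {n : ℕ} (h : HasPattern (fun y x => R x y) (2 ^ n)) :
    HasPattern R n := by
  classical
  obtain ⟨y, x, hxy⟩ := h
  let e : Set (Fin n) ≃ Fin (2 ^ n) := Fintype.equivFinOfCardEq (by simp)
  refine ⟨fun i => x {j | i ∈ e.symm j}, fun S => y (e S), fun i S => ?_⟩
  refine (hxy _ _).trans ?_
  simp

/-- The sets `{x | R x y}` cut out at most `(n + 1) ^ d` subsets of an `n`-element index set. -/
def PolyGrowth {X : Type*} {Y : Type*} (d : ℕ) (R : X → Y → Prop) : Prop :=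
  ∀ (ι : Type) [Fintype ι] (b : ι → X),
    (Set.range fun y => {i | R (b i) y}).ncard ≤ (Fintype.card ι + 1) ^ d

theorem sum_choose_le_succ_pow (n d : ℕ) :
    ∑ k ∈ Finset.range d, n.choose k ≤ (n + 1) ^ d := by
  have h1 : ∀ d, ∑ k ∈ Finset.range (d + 1), n ^ k ≤ (n + 1) ^ d := by
    intro d
    rw [add_pow]
    refine Finset.sum_le_sum fun k hk => ?_
    simp only [one_pow, mul_one]
    exact Nat.le_mul_of_pos_right _ (Nat.choose_pos (by simpa [Nat.lt_succ_iff] using hk))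
  refine le_trans ?_ (h1 d)
  rw [Finset.sum_range_succ]
  exact le_add_right (Finset.sum_le_sum fun k _ => Nat.choose_le_pow n k)

/-- Pajor's form of Sauer–Shelah: a family has at most as many members as it shatters sets, and here
these have fewer than `d` elements. -/
theorem polyGrowth_of_not_hasPattern {d : ℕ} (h : ¬ HasPattern R d) : PolyGrowth d R := by
  classical
  intro ι _ b
  let 𝒜 : Finset (Finset ι) := Finset.univ.filter fun s => ∃ y, ∀ i, i ∈ s ↔ R (b i) y
  have hcard : (Set.range fun y => {i | R (b i) y}).ncard ≤ 𝒜.card := by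
    have : (Set.range fun y => {i | R (b i) y}) =
        (fun s : Finset ι => (s : Set ι)) '' (𝒜 : Set (Finset ι)) := by
      ext S
      constructor
      · rintro ⟨y, rfl⟩
        refine ⟨Finset.univ.filter fun i => R (b i) y, ?_, by ext; simp⟩
        simp only [𝒜, Finset.coe_filter, Finset.mem_univ, true_and, Set.mem_ofPred_eq]
        exact ⟨y, by simp⟩
      · rintro ⟨s, hs, rfl⟩
        simp only [𝒜, Finset.coe_filter, Finset.mem_univ, true_and, Set.mem_ofPred_eq] at hs
        obtain ⟨y, hy⟩ := hs
        exact ⟨y, by ext i; simp [hy]⟩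
    rw [this]
    exact (Set.ncard_image_le (Finset.finite_toSet _)).trans (by simp)
  have hsh : ∀ s : Finset ι, 𝒜.Shatters s → s.card < d := by
    intro s hs
    by_contra! hd
    refine h (HasPattern.mono hd ?_)
    let e := s.equivFin.symm
    have key : ∀ S : Set (Fin s.card), ∃ y : Y, ∀ i, R (b (e i)) y ↔ i ∈ S := by
      intro S
      obtain ⟨t, ht, hst⟩ := hs (t := (Finset.univ.filter (· ∈ S)).image fun i => (e i : ι)) (by
        intro x hx
        obtain ⟨i, -, rfl⟩ := Finset.mem_image.1 hx
        exact (e i).2)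
      simp only [𝒜, Finset.mem_filter, Finset.mem_univ, true_and] at ht
      obtain ⟨y, hy⟩ := ht
      refine ⟨y, fun i => ?_⟩
      have h1 := Finset.ext_iff.1 hst (e i)
      simp only [Finset.mem_inter, hy, Finset.coe_mem, true_and, Finset.mem_image,
        Finset.mem_filter, Finset.mem_univ, SetLike.coe_eq_coe, EmbeddingLike.apply_eq_iff_eq,
        exists_eq_right] at h1
      exact h1
    choose y hy using key
    exact ⟨fun i => b (e i), y, fun i S => hy S i⟩
  refine hcard.trans (𝒜.card_le_card_shatterer.trans ?_)
  refine le_trans ?_ (sum_choose_le_succ_pow (Fintype.card ι) d)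
  simp_rw [← Finset.card_univ (α := ι), ← Finset.card_powersetCard]
  refine (Finset.card_le_card fun s hs => Finset.mem_biUnion.2 ⟨s.card, ?_⟩).trans
    Finset.card_biUnion_le
  exact ⟨Finset.mem_range.2 (hsh s (Finset.mem_shatterer.1 hs)),
    Finset.mem_powersetCard_univ.2 rfl⟩

theorem PolyGrowth.comap {Z : Type*} {d : ℕ} (h : PolyGrowth d R) (f : Z → X) :
    PolyGrowth d fun z y => R (f z) y :=
  fun ι _ b => h ι (f ∘ b)

/-- Used to pass from hypotheses to their error sets: symmetric difference with a fixed set does not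
increase the number of traces. -/
theorem PolyGrowth.xor {d : ℕ} (h : PolyGrowth d R) (P : X → Prop) :
    PolyGrowth d fun x y => ¬ (R x y ↔ P x) := by
  intro ι _ b
  have : (Set.range fun y => {i | ¬ (R (b i) y ↔ P (b i))}) =
      (fun S => {i | ¬ (i ∈ S ↔ P (b i))}) '' (Set.range fun y => {i | R (b i) y}) := by
    rw [← Set.range_comp]
    rfl
  rw [this]
  exact (Set.ncard_image_le (Set.toFinite _)).trans (h ι b)

end Pattern

/-! ### Random halving of samples -/

/-- The real number `1` or `0` according to whether `p` holds. -/
noncomputable def indicatorReal (p : Prop) : ℝ := open Classical in if p then 1 else 0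

theorem indicatorReal_nonneg (p : Prop) : 0 ≤ indicatorReal p := by
  unfold indicatorReal; split <;> norm_num

theorem indicatorReal_le_one (p : Prop) : indicatorReal p ≤ 1 := by
  unfold indicatorReal; split <;> norm_num

/-- The proportion of indices at which `P` holds. -/
noncomputable def freq {ι : Type*} [Fintype ι] (P : ι → Prop) : ℝ :=
  (∑ i, indicatorReal (P i)) / Fintype.card ι

/-- The random signs `1` and `-1`. -/
def sign (b : Bool) : ℝ := if b then 1 else -1

/-- The signs are independent, so the sum factors into terms `2 * cosh (l * v i)`, and `cosh t ≤ exp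
(t ^ 2 / 2)`. -/
theorem sum_exp_signs {n : ℕ} (v : Fin n → ℝ) (hv : ∀ i, |v i| ≤ 1) (l : ℝ) :
    ∑ s : Fin n → Bool, Real.exp (l * ∑ i, sign (s i) * v i) ≤
      2 ^ n * Real.exp (l ^ 2 * n / 2) := by
  have h1 : ∀ s : Fin n → Bool, Real.exp (l * ∑ i, sign (s i) * v i) =
      ∏ i, Real.exp (l * (sign (s i) * v i)) := by
    intro s
    rw [← Real.exp_sum, Finset.mul_sum]
  simp_rw [h1]
  rw [← Fintype.piFinset_univ,
    ← Finset.prod_univ_sum (fun _ => Finset.univ) (fun i b => Real.exp (l * (sign b * v i)))]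
  have h2 : ∀ i, ∑ b, Real.exp (l * (sign b * v i)) ≤ 2 * Real.exp (l ^ 2 / 2) := by
    intro i
    have h3 : ∑ b, Real.exp (l * (sign b * v i)) = 2 * Real.cosh (l * v i) := by
      rw [Fintype.sum_bool, Real.cosh_eq]
      simp only [sign, if_true, Bool.false_eq_true, if_false]
      ring_nf
    rw [h3]
    have h4 : (l * v i) ^ 2 ≤ l ^ 2 := by
      rw [mul_pow]
      exact mul_le_of_le_one_right (sq_nonneg _) ((sq_le_one_iff_abs_le_one _).2 (hv i))
    have h5 := Real.cosh_le_exp_half_sq (l * v i)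
    have h6 : Real.exp ((l * v i) ^ 2 / 2) ≤ Real.exp (l ^ 2 / 2) := Real.exp_le_exp.2 (by linarith)
    linarith
  calc ∏ i, ∑ b, Real.exp (l * (sign b * v i)) ≤ ∏ _i : Fin n, (2 * Real.exp (l ^ 2 / 2)) :=
        Finset.prod_le_prod (fun i _ => Finset.sum_nonneg fun _ _ => (Real.exp_pos _).le)
          fun i _ => h2 i
    _ = 2 ^ n * Real.exp (l ^ 2 * n / 2) := by
        rw [Finset.prod_const, Finset.card_univ, Fintype.card_fin, mul_pow, ← Real.exp_nat_mul]
        ring_nf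

/-- Chernoff's bound with a union bound over `V`: some choice of signs does no worse than the
average of the summed exponential moments. -/
theorem exists_signs_of_card_le {n : ℕ} (V : Finset (Fin n → ℝ)) (hV : ∀ v ∈ V, ∀ i, |v i| ≤ 1)
    {K : ℝ} (hK : 0 < K) (hcard : (V.card : ℝ) ≤ K) {l : ℝ} (hl : 0 < l) :
    ∃ s : Fin n → Bool, ∀ v ∈ V,
      |∑ i, sign (s i) * v i| ≤ Real.log (2 * K) / l + l * n / 2 := by
  set E := Real.exp (l ^ 2 * n / 2) with hE
  have hEpos : 0 < E := Real.exp_pos _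
  obtain ⟨s, -, hs⟩ : ∃ s ∈ (Finset.univ : Finset (Fin n → Bool)),
      ∑ v ∈ V, (Real.exp (l * ∑ i, sign (s i) * v i) + Real.exp (-l * ∑ i, sign (s i) * v i)) ≤
        2 * K * E := by
    refine Finset.exists_le_of_sum_le Finset.univ_nonempty ?_
    rw [Finset.sum_comm]
    have h1 : ∀ v ∈ V, ∑ s : Fin n → Bool, (Real.exp (l * ∑ i, sign (s i) * v i) +
        Real.exp (-l * ∑ i, sign (s i) * v i)) ≤ 2 * (2 ^ n * E) := by
      intro v hv
      rw [Finset.sum_add_distrib]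
      have h2 := sum_exp_signs v (hV v hv) l
      have h3 := sum_exp_signs v (hV v hv) (-l)
      rw [neg_sq] at h3
      linarith
    refine (Finset.sum_le_sum h1).trans ?_
    simp only [Finset.sum_const, nsmul_eq_mul, Finset.card_univ, Fintype.card_fun,
      Fintype.card_bool, Fintype.card_fin, Nat.cast_pow, Nat.cast_ofNat]
    have : 0 ≤ 2 * (2 ^ n * E) := by positivity
    nlinarith
  refine ⟨s, fun v hv => ?_⟩
  set t := ∑ i, sign (s i) * v i with ht
  have h1 : Real.exp (l * |t|) ≤ 2 * K * E := by
    let f : (Fin n → ℝ) → ℝ := fun v =>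
      Real.exp (l * ∑ i, sign (s i) * v i) + Real.exp (-l * ∑ i, sign (s i) * v i)
    have hf₀ : ∀ v, 0 ≤ f v := fun v => add_nonneg (Real.exp_pos _).le (Real.exp_pos _).le
    have hf : f v ≤ ∑ v ∈ V, f v := Finset.single_le_sum (fun v _ => hf₀ v) hv
    refine le_trans ?_ (hf.trans hs)
    change _ ≤ Real.exp (l * t) + Real.exp (-l * t)
    have ha := Real.exp_pos (l * t)
    have hb := Real.exp_pos (-l * t)
    rcases abs_cases t with ⟨h, -⟩ | ⟨h, -⟩
    · rw [h]; linarith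
    · rw [h, mul_neg, ← neg_mul]; linarith
  have h2 := Real.log_le_log (Real.exp_pos _) h1
  rw [Real.log_exp, Real.log_mul (by positivity) hEpos.ne', hE, Real.log_exp] at h2
  have h3 : |t| = (l * |t|) / l := by field_simp
  rw [h3]
  have h4 : Real.log (2 * K) / l + l * n / 2 = (Real.log (2 * K) + l ^ 2 * n / 2) / l := by
    field_simp
  rw [h4]
  gcongr

variable {X : Type*} {Y : Type*} {R : X → Y → Prop} {d : ℕ}

theorem freq_comp_equiv {ι κ : Type*} [Fintype ι] [Fintype κ] (e : ι ≃ κ) (P : κ → Prop) :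
    freq (fun i => P (e i)) = freq P := by
  unfold freq
  rw [Fintype.card_congr e, Equiv.sum_comp e fun k => indicatorReal (P k)]

/-- Keeping one point of each pair changes the frequency by a signed sum of the differences within
pairs. -/
theorem freq_prod_bool {n : ℕ} (P : Fin n × Bool → Prop) (s : Fin n → Bool) :
    freq (fun i => P (i, s i)) - freq P =
      (∑ i, sign (s i) * (indicatorReal (P (i, true)) - indicatorReal (P (i, false)))) /
        (2 * n) := by
  rcases Nat.eq_zero_or_pos n with rfl | hn
  · simp [freq]
  have hn' : (n : ℝ) ≠ 0 := by positivity
  unfold freq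
  rw [Fintype.sum_prod_type]
  simp only [Fintype.card_fin, Fintype.card_prod, Fintype.card_bool, Fintype.sum_bool,
    Nat.cast_mul, Nat.cast_ofNat]
  field_simp
  rw [Finset.sum_mul, ← Finset.sum_sub_distrib]
  refine Finset.sum_congr rfl fun i _ => ?_
  cases s i <;> simp [sign] <;> ring

/-- The error allowed when a sample of size `2 ^ (j + 1)` is halved. -/
noncomputable def halvingError (d j : ℕ) : ℝ :=
  (1 + d * (j + 2)) * (2 / 3) ^ j + (3 / 4) ^ j

theorem halvingError_nonneg (d j : ℕ) : 0 ≤ halvingError d j := by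
  unfold halvingError; positivity

theorem summable_halvingError (d : ℕ) : Summable (halvingError d) := by
  have h1 : Summable fun n : ℕ => (n : ℝ) ^ 1 * (2 / 3 : ℝ) ^ n :=
    summable_pow_mul_geometric_of_norm_lt_one 1 (by norm_num [abs_of_pos])
  have h2 : Summable fun n : ℕ => (2 / 3 : ℝ) ^ n :=
    summable_geometric_of_lt_one (by norm_num) (by norm_num)
  have h3 : Summable fun n : ℕ => (3 / 4 : ℝ) ^ n :=
    summable_geometric_of_lt_one (by norm_num) (by norm_num)
  refine (((h2.mul_left (1 + 2 * d : ℝ)).add (h1.mul_left (d : ℝ))).add h3).congr fun n => ?_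
  unfold halvingError
  ring

theorem log_growth_le (d j : ℕ) :
    Real.log (2 * ((2 : ℝ) ^ (j + 1) + 1) ^ d) ≤ 1 + d * (j + 2) := by
  have h0 : (1 : ℝ) ≤ 2 ^ (j + 1) := one_le_pow₀ (by norm_num)
  have h1 : 2 * ((2 : ℝ) ^ (j + 1) + 1) ^ d ≤ 2 ^ (1 + d * (j + 2)) := by
    rw [pow_add 2 1, pow_one, mul_comm d, pow_mul]
    gcongr
    rw [pow_succ 2 (j + 1)]
    linarith
  refine (Real.log_le_log (by positivity) h1).trans ?_
  rw [Real.log_pow]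
  have h2 : Real.log 2 ≤ 1 := by linarith [Real.log_le_sub_one_of_pos (x := 2) (by norm_num)]
  push_cast
  exact mul_le_of_le_one_right (by positivity) h2

theorem PolyGrowth.exists_half (h : PolyGrowth d R) (j : ℕ) (x : Fin (2 ^ (j + 1)) → X) :
    ∃ x' : Fin (2 ^ j) → X, ∀ y,
      |freq (fun i => R (x' i) y) - freq (fun i => R (x i) y)| ≤ halvingError d j := by
  classical
  let e : Fin (2 ^ j) × Bool ≃ Fin (2 ^ (j + 1)) :=
    Fintype.equivOfCardEq (by simp [pow_succ])
  let vec : Set (Fin (2 ^ j) × Bool) → Fin (2 ^ j) → ℝ := fun S i =>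
    indicatorReal ((i, true) ∈ S) - indicatorReal ((i, false) ∈ S)
  let V : Finset (Fin (2 ^ j) → ℝ) :=
    ((Set.toFinite (Set.range fun y => {p | R (x (e p)) y})).toFinset).image vec
  have hcard : (V.card : ℝ) ≤ ((2 : ℝ) ^ (j + 1) + 1) ^ d := by
    have h1 := h (Fin (2 ^ j) × Bool) fun p => x (e p)
    rw [Set.ncard_eq_toFinset_card _ (Set.toFinite _), Fintype.card_congr e, Fintype.card_fin] at h1
    exact_mod_cast Finset.card_image_le.trans h1
  have hV : ∀ v ∈ V, ∀ i, |v i| ≤ 1 := by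
    intro v hv i
    obtain ⟨S, -, rfl⟩ := Finset.mem_image.1 hv
    rw [abs_le]
    constructor <;>
    linarith [indicatorReal_nonneg ((i, true) ∈ S), indicatorReal_le_one ((i, true) ∈ S),
      indicatorReal_nonneg ((i, false) ∈ S), indicatorReal_le_one ((i, false) ∈ S)]
  -- After division by the sample size, the error terms are of order `j / (2 * r) ^ j` and `r ^ j`
  -- for `l = r ^ j`; both are summable when `1/2 < r < 1`, and `r = 3/4` is one choice.
  obtain ⟨s, hs⟩ := exists_signs_of_card_le V hV (by positivity) hcard
    (l := (3 / 4) ^ j) (by positivity)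
  refine ⟨fun i => x (e (i, s i)), fun y => ?_⟩
  have hy := hs (vec {p | R (x (e p)) y}) (Finset.mem_image_of_mem _ (by simp))
  rw [← freq_comp_equiv e, freq_prod_bool (fun p => R (x (e p)) y) s, abs_div]
  have hpos : (0 : ℝ) < 2 ^ j := by positivity
  have h2 : |(2 * ((2 ^ j : ℕ) : ℝ))| = 2 * 2 ^ j := by
    rw [abs_of_pos (by positivity)]
    push_cast
    rfl
  rw [h2, div_le_iff₀ (by positivity)]
  refine hy.trans ?_
  have h3 : halvingError d j * (2 * 2 ^ j) =
      2 * (1 + d * (j + 2)) / (3 / 4) ^ j + 2 * ((3 / 4) ^ j * 2 ^ j) := by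
    unfold halvingError
    have : (2 / 3 : ℝ) ^ j * 2 ^ j * (3 / 4) ^ j = 1 := by
      rw [← mul_pow, ← mul_pow]; norm_num
    have h34 : ((3 / 4 : ℝ) ^ j) ≠ 0 := by positivity
    rw [eq_comm, ← sub_eq_zero]
    field_simp
    linear_combination (-2) * (1 + d * ((j : ℝ) + 2)) * this
  rw [h3]
  push_cast
  have h4 : (0 : ℝ) ≤ (3 / 4) ^ j * 2 ^ j := by positivity
  have h5 : Real.log (2 * ((2 : ℝ) ^ (j + 1) + 1) ^ d) / (3 / 4) ^ j ≤
      2 * (1 + d * (j + 2)) / (3 / 4) ^ j := by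
    gcongr
    refine (log_growth_le d j).trans ?_
    have : (0 : ℝ) ≤ 1 + d * (j + 2) := by positivity
    linarith
  linarith

theorem PolyGrowth.exists_subsample (h : PolyGrowth d R) (m k : ℕ) (x : Fin (2 ^ (m + k)) → X) :
    ∃ x' : Fin (2 ^ m) → X, ∀ y,
      |freq (fun i => R (x' i) y) - freq (fun i => R (x i) y)| ≤
        ∑ j ∈ Finset.range k, halvingError d (j + m) := by
  induction k with
  | zero => exact ⟨x, fun y => by simp⟩
  | succ k ih =>
    obtain ⟨x₁, hx₁⟩ := h.exists_half (m + k) x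
    obtain ⟨x₂, hx₂⟩ := ih x₁
    refine ⟨x₂, fun y => ?_⟩
    rw [Finset.sum_range_succ, add_comm k m]
    exact (abs_sub_le _ _ _).trans (add_le_add (hx₂ y) (hx₁ y))

/-! ### From weights to approximations of bounded size -/

/-- A function on `Fin N` with prescribed fiber sizes. -/
theorem exists_sample_of_counts [Fintype X] {N : ℕ} (c : X → ℕ) (hc : ∑ x, c x = N) :
    ∃ x : Fin N → X, ∀ P : X → Prop,
      freq (fun i => P (x i)) = ∑ a, c a * indicatorReal (P a) / N := by
  let e : Fin N ≃ Σ a, Fin (c a) := Fintype.equivOfCardEq (by simp [hc])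
  refine ⟨fun i => (e i).1, fun P => ?_⟩
  rw [freq_comp_equiv e (fun p => P p.1)]
  unfold freq
  rw [Fintype.sum_sigma, Finset.sum_div]
  simp [hc]

theorem exists_sample_of_weights [Fintype X] {w : X → ℝ} (hw : w ∈ stdSimplex ℝ X) {N : ℕ}
    (hN : 0 < N) :
    ∃ x : Fin N → X, ∀ P : X → Prop,
      |freq (fun i => P (x i)) - ∑ a, w a * indicatorReal (P a)| ≤ 2 * Fintype.card X / N := by
  classical
  have hX : Nonempty X := by
    by_contra hX
    rw [not_nonempty_iff] at hX
    simpa using hw.2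
  let x₀ : X := Classical.arbitrary X
  let c₀ : X → ℕ := fun a => ⌊N * w a⌋₊
  have hN' : (0 : ℝ) < N := by exact_mod_cast hN
  have hc₀ : ∀ a, (c₀ a : ℝ) ≤ N * w a := fun a => Nat.floor_le (mul_nonneg hN'.le (hw.1 a))
  have hc₁ : ∀ a, N * w a < c₀ a + 1 := fun a => Nat.lt_floor_add_one _
  have hwsum : ∑ a, N * w a = (N : ℝ) := by rw [← Finset.mul_sum, hw.2, mul_one]
  have hsum : ∑ a, c₀ a ≤ N := by
    have : (∑ a, c₀ a : ℝ) ≤ N := (Finset.sum_le_sum fun a _ => hc₀ a).trans hwsum.le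
    exact_mod_cast this
  have hrest : ((N - ∑ a, c₀ a : ℕ) : ℝ) ≤ Fintype.card X := by
    rw [Nat.cast_sub hsum]
    push_cast
    have : (N : ℝ) ≤ ∑ a, ((c₀ a : ℝ) + 1) :=
      hwsum.symm.le.trans (Finset.sum_le_sum fun a _ => (hc₁ a).le)
    rw [Finset.sum_add_distrib] at this
    simp at this
    linarith
  -- Rounding down loses less than one unit per point; the whole deficit, at most `Fintype.card X`,
  -- goes to `x₀`.
  let c : X → ℕ := fun a => c₀ a + if a = x₀ then N - ∑ a, c₀ a else 0
  obtain ⟨x, hx⟩ := exists_sample_of_counts (N := N) c (by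
    simp only [c, Finset.sum_add_distrib, Finset.sum_ite_eq', Finset.mem_univ, if_true]
    omega)
  refine ⟨x, fun P => ?_⟩
  rw [hx, ← Finset.sum_sub_distrib]
  have hterm : ∀ a, |c a * indicatorReal (P a) / N - w a * indicatorReal (P a)| ≤
      (1 + if a = x₀ then (Fintype.card X : ℝ) else 0) / N := by
    intro a
    have h1 : c a * indicatorReal (P a) / N - w a * indicatorReal (P a) =
        (c a - N * w a) * indicatorReal (P a) / N := by field_simp
    rw [h1, abs_div, abs_of_pos hN', abs_mul, abs_of_nonneg (indicatorReal_nonneg _)]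
    gcongr
    refine (mul_le_of_le_one_right (abs_nonneg _) (indicatorReal_le_one _)).trans ?_
    have h2 : (c a : ℝ) - N * w a =
        (c₀ a - N * w a) + ((if a = x₀ then N - ∑ a, c₀ a else 0 : ℕ) : ℝ) := by
      simp only [c, Nat.cast_add]; ring
    rw [h2]
    refine (abs_add_le _ _).trans (add_le_add ?_ ?_)
    · rw [abs_le]
      constructor <;> linarith [hc₀ a, hc₁ a]
    · rw [Nat.abs_cast]
      split_ifs
      · exact hrest
      · simp
  refine (Finset.abs_sum_le_sum_abs _ _).trans ((Finset.sum_le_sum fun a _ => hterm a).trans ?_)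
  rw [← Finset.sum_div, Finset.sum_add_distrib]
  simp only [Finset.sum_const, Finset.card_univ, nsmul_eq_mul, mul_one, Finset.sum_ite_eq',
    Finset.mem_univ, if_true]
  gcongr
  linarith

/-- Set systems of polynomial growth have `ε`-approximations of bounded size. -/
theorem exists_approx_size (d : ℕ) {ε : ℝ} (hε : 0 < ε) :
    ∃ N : ℕ, 0 < N ∧ ∀ {X : Type u} {Y : Type v} [Fintype X] {R : X → Y → Prop},
      PolyGrowth d R → ∀ w ∈ stdSimplex ℝ X, ∃ x : Fin N → X, ∀ y,
        |freq (fun i => R (x i) y) - ∑ a, w a * indicatorReal (R a y)| ≤ ε := by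
  have h1 := tendsto_sum_nat_add (halvingError d)
  -- Halving stops at size `2 ^ m`, where all earlier halvings together cost less than `ε / 2`. Only
  -- the initial size `2 ^ (m + k)` depends on `X`.
  obtain ⟨m, hm⟩ := (h1.eventually (gt_mem_nhds (half_pos hε))).exists
  refine ⟨2 ^ m, by positivity, fun {X Y _ R} hR w hw => ?_⟩
  obtain ⟨k, hk⟩ : ∃ k : ℕ, 2 * (Fintype.card X : ℝ) / (ε / 2) < 2 ^ k :=
    pow_unbounded_of_one_lt _ (by norm_num)
  obtain ⟨x, hx⟩ := exists_sample_of_weights hw (N := 2 ^ (m + k)) (by positivity)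
  obtain ⟨x', hx'⟩ := hR.exists_subsample m k x
  refine ⟨x', fun y => ?_⟩
  have h2 : 2 * (Fintype.card X : ℝ) / ((2 ^ (m + k) : ℕ) : ℝ) ≤ ε / 2 := by
    push_cast
    rw [div_lt_iff₀ (by positivity)] at hk
    rw [div_le_iff₀ (by positivity), pow_add]
    have : (1 : ℝ) ≤ 2 ^ m := one_le_pow₀ (by norm_num)
    have h3 : (0 : ℝ) ≤ ε / 2 * 2 ^ k := by positivity
    nlinarith
  have h3 : ∑ j ∈ Finset.range k, halvingError d (j + m) ≤ ε / 2 :=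
    (((summable_nat_add_iff m).2 (summable_halvingError d)).sum_le_tsum _
      fun j _ => halvingError_nonneg d _).trans hm.le
  have h4 := hx fun a => R a y
  have h5 := hx' y
  refine (abs_sub_le _ (freq fun i => R (x i) y) _).trans ?_
  linarith [h5.trans h3, h4.trans h2]

/-! ### Minimax and sample compression -/

/-- A form of von Neumann's minimax theorem for finite matrix games. -/
theorem exists_mixed_strategy {Z : Type*} {A : Type*} [Fintype Z] [Fintype A] [Nonempty Z]
    [Nonempty A] (E : Z → A → ℝ) (c : ℝ)
    (h : ∀ q ∈ stdSimplex ℝ A, ∃ z, ∑ a, q a * E z a ≤ c) :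
    ∃ w ∈ stdSimplex ℝ Z, ∀ a, ∑ z, w z * E z a ≤ c := by
  classical
  let B : (Z → ℝ) →ₗ[ℝ] (A → ℝ) →ₗ[ℝ] ℝ := Matrix.toLinearMap₂' ℝ (Matrix.of E)
  have hB : ∀ w q, B w q = ∑ z, ∑ a, w z * q a * E z a := by
    intro w q
    simp only [B, Matrix.toLinearMap₂'_apply, Matrix.of_apply, smul_eq_mul, mul_assoc]
  obtain ⟨w, hw, q, hq, hwq⟩ := Sion.exists_isSaddlePointOn (f := fun w q => B w q)
    ⟨_, single_mem_stdSimplex ℝ (Classical.arbitrary Z)⟩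
    (convex_stdSimplex ℝ Z) (isCompact_stdSimplex ℝ Z)
    (fun q _ => (B.flip q).continuous_of_finiteDimensional.lowerSemicontinuous.lowerSemicontinuousOn
      _)
    (fun q _ => ((B.flip q).convexOn (convex_stdSimplex ℝ Z)).quasiconvexOn)
    (convex_stdSimplex ℝ A) ⟨_, single_mem_stdSimplex ℝ (Classical.arbitrary A)⟩
    (isCompact_stdSimplex ℝ A)
    (fun w _ => (B w).continuous_of_finiteDimensional.upperSemicontinuous.upperSemicontinuousOn _)
    (fun w _ => ((B w).concaveOn (convex_stdSimplex ℝ A)).quasiconcaveOn)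
  refine ⟨w, hw, fun a => ?_⟩
  obtain ⟨z, hz⟩ := h q hq
  -- At the saddle point, `w` against the pure strategy `a` pays at most what the pure strategy `z`
  -- pays against `q`.
  have h1 := hwq _ (single_mem_stdSimplex ℝ z) _ (single_mem_stdSimplex ℝ a)
  simp only [hB] at h1
  simp only [Pi.single_apply, mul_ite, mul_one, mul_zero, ite_mul, zero_mul, one_mul,
    Finset.sum_ite_eq', Finset.mem_univ, if_true] at h1
  rw [Finset.sum_comm] at h1
  simp only [Finset.sum_ite_eq', Finset.mem_univ, if_true] at h1
  linarith

theorem freq_fin (m : ℕ) (P : Fin m → Prop) : freq P = ({t | P t}.ncard : ℝ) / m := by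
  classical
  unfold freq indicatorReal
  rw [Fintype.card_fin, Set.ncard_eq_toFinset_card', Finset.sum_boole]
  congr 3
  ext
  simp

/-- The sample compression scheme of Moran and Yehudayoff, for an arbitrary rule `H` that maps a
small sample to a hypothesis consistent with it. -/
theorem exists_compression_size (d : ℕ) :
    ∃ s m : ℕ, 0 < s ∧ 0 < m ∧ ∀ {X : Type u} {Y : Type v} {R : X → Y → Prop},
      PolyGrowth d R → PolyGrowth d (fun y x => R x y) →
      ∀ (A : Set Y), A.Finite → A.Nonempty → ∀ (x₀ : X) (H : (Fin s → A) → X),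
        (∀ Z i, R (H Z) (Z i) ↔ R x₀ (Z i)) →
        ∃ Z : Fin m → Fin s → A, ∀ a ∈ A,
          (R x₀ a ↔ m < 2 * {t | R (H (Z t)) a}.ncard) := by
  classical
  -- The two errors must add up to less than 1/2 for the majority to be right: 1/3 + 1/8 = 11/24.
  obtain ⟨s, hs, hs'⟩ := exists_approx_size.{v, u} d (ε := 1 / 3) (by norm_num)
  obtain ⟨m, hm, hm'⟩ := exists_approx_size.{v, v} d (ε := 1 / 8) (by norm_num)
  refine ⟨s, m, hs, hm, ?_⟩
  intro X Y R hR hR' A hA hA' x₀ H hH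
  have := hA.fintype
  have := hA'.to_subtype
  obtain ⟨w, hw, hwa⟩ := exists_mixed_strategy
    (fun (Z : Fin s → A) (a : A) => indicatorReal (¬ (R (H Z) a ↔ R x₀ a))) (1 / 3) (by
      intro q hq
      -- The sample `Z` approximates the `q`-mass of every error set. As `H Z` makes no error on
      -- `Z`, its error set has mass at most 1/3.
      obtain ⟨Z, hZ⟩ := hs' (R := fun (a : A) x => ¬ (R x a ↔ R x₀ a))
        ((hR'.comap Subtype.val).xor fun a : A => R x₀ a) q hq
      refine ⟨Z, ?_⟩
      have h1 := hZ (H Z)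
      have h2 : freq (fun i => ¬ (R (H Z) (Z i) ↔ R x₀ (Z i))) = 0 := by
        simp [freq, hH, indicatorReal]
      rw [h2, zero_sub, abs_neg] at h1
      exact (abs_le.1 h1).2)
  obtain ⟨Z, hZ⟩ := hm' (R := fun (Z : Fin s → A) (a : A) => R (H Z) a)
    (by
      intro ι _ b
      refine le_trans (Set.ncard_le_ncard ?_ (Set.toFinite _)) (hR ι fun i => H (b i))
      rintro _ ⟨a, rfl⟩
      exact ⟨a, rfl⟩) w hw
  refine ⟨Z, fun a ha => ?_⟩
  have h1 := hZ ⟨a, ha⟩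
  have h2 := hwa ⟨a, ha⟩
  rw [freq_fin m fun t => R (H (Z t)) a] at h1
  have hm₀ : (0 : ℝ) < m := by exact_mod_cast hm
  rw [← Nat.cast_lt (α := ℝ)]
  push_cast
  rw [abs_le] at h1
  dsimp only at h1 h2
  set n := {t | R (H (Z t)) a}.ncard
  by_cases hx : R x₀ a
  · have h3 : ∑ Z, w Z * indicatorReal (¬ (R (H Z) a ↔ R x₀ a)) =
        1 - ∑ Z, w Z * indicatorReal (R (H Z) a) := by
      rw [← hw.2, ← Finset.sum_sub_distrib]
      refine Finset.sum_congr rfl fun Z _ => ?_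
      by_cases h : R (H Z) a <;> simp [h, hx, indicatorReal]
    rw [h3] at h2
    refine iff_of_true hx ?_
    have h4 : (1 / 2 : ℝ) < n / m := by linarith
    rw [lt_div_iff₀ hm₀] at h4
    linarith
  · have h3 : ∑ Z, w Z * indicatorReal (¬ (R (H Z) a ↔ R x₀ a)) =
        ∑ Z, w Z * indicatorReal (R (H Z) a) := by
      refine Finset.sum_congr rfl fun Z _ => ?_
      by_cases h : R (H Z) a <;> simp [h, hx, indicatorReal]
    rw [h3] at h2
    refine iff_of_false hx ?_
    have h4 : (n / m : ℝ) < 1 / 2 := by linarith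
    rw [div_lt_iff₀ hm₀] at h4
    linarith

/-! ### NIP for combinations of boundedly many instances -/

theorem exists_succ_pow_lt_two_pow (K : ℕ) : ∃ n : ℕ, (n + 1) ^ K < 2 ^ n := by
  have h1 := (tendsto_pow_const_div_const_pow_of_one_lt K (r := (2 : ℝ)) (by norm_num)).comp
    (Filter.tendsto_add_atTop_nat 1)
  obtain ⟨n, hn⟩ := (h1.eventually (gt_mem_nhds (show (0 : ℝ) < 1 / 2 by norm_num))).exists
  refine ⟨n, ?_⟩
  rw [Function.comp_apply, div_lt_iff₀ (by positivity), pow_succ 2 n] at hn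
  have h2 : ((n + 1 : ℕ) : ℝ) ^ K < 2 ^ n := by linarith
  exact_mod_cast h2

/-- A subset of `n` points cut out by the combination is determined by `m` traces of `R`, so a
pattern of size `n` would force `2 ^ n ≤ (n + 1) ^ (d * m)`. -/
theorem PolyGrowth.exists_not_hasPattern_comb {X : Type*} {Y : Type*} {Z : Type*} {d m : ℕ}
    {R : X → Y → Prop} (h : PolyGrowth d fun y x => R x y) (F : Fin m → Z → X)
    (Q : Set (Fin m) → Prop) : ∃ n, ¬ HasPattern (fun y z => Q {t | R (F t z) y}) n := by
  obtain ⟨n, hn⟩ := exists_succ_pow_lt_two_pow (d * m)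
  refine ⟨n, ?_⟩
  rintro ⟨b, a, hab⟩
  let T := Set.range fun x => {i | R x (b i)}
  have hT : Nat.card T ≤ (n + 1) ^ d := by simpa using h (Fin n) b
  let g : Set (Fin n) → Fin m → T := fun S t => ⟨{i | R (F t (a S)) (b i)}, F t (a S), rfl⟩
  have hg : Function.Injective g := by
    intro S S' hSS
    ext i
    rw [← hab i S, ← hab i S']
    have h1 : {t | R (F t (a S)) (b i)} = {t | R (F t (a S')) (b i)} := by
      ext t
      have h2 : {i | R (F t (a S)) (b i)} = {i | R (F t (a S')) (b i)} :=
        congrArg Subtype.val (congrFun hSS t)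
      exact Set.ext_iff.1 h2 i
    exact iff_of_eq (congrArg Q h1)
  have h1 := Nat.card_le_card_of_injective g hg
  have h2 : Nat.card (Set (Fin n)) = 2 ^ n := by simp
  rw [h2, Nat.card_fun, Nat.card_eq_fintype_card (α := Fin m), Fintype.card_fin] at h1
  have h3 := h1.trans (Nat.pow_le_pow_left hT m)
  rw [← pow_mul] at h3
  omega

/-! ### A VC bound uniform in the model -/

section Compactness

variable {L : FirstOrder.Language.{u, v}} {α β : Type} {T : L.Theory} {φ : L.Formula (α ⊕ β)}

theorem isNIP_iff : IsNIP.{u, v, w} T φ ↔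
    ∀ M : T.ModelType.{u, v, max u v w}, ∃ n,
      ¬ HasPattern (fun (b : α → M) (a : β → M) => Holds φ b a) n :=
  forall_congr' fun _ => isVCClass_iff_exists_not_hasPattern

/-- By compactness, the bound in the definition of NIP does not depend on the model. -/
theorem IsNIP.exists_uniform (h : IsNIP.{u, v, w} T φ) :
    ∃ n, ∀ M : T.ModelType.{u, v, max u v w},
      ¬ HasPattern (fun (b : α → M) (a : β → M) => Holds φ b a) n := by
  classical
  by_contra! hcon
  choose M b a hab using hcon
  let U := Filter.hyperfilter ℕ
  let P := (U : Filter ℕ).Product fun n => (M n : Type (max u v w))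
  have hP : P ⊨ T := ⟨fun σ hσ => (Ultraproduct.sentence_realize σ).2
    (Filter.Eventually.of_forall fun n => Theory.realize_sentence_of_mem T hσ)⟩
  have : Nonempty P := Ultraproduct.Product.instNonempty
  obtain ⟨n, hn⟩ := isNIP_iff.1 h (Theory.ModelType.of T P)
  refine hn ?_
  -- The coordinates `N ≤ i`, where the pattern of size `N` has no `i`-th point, are finitely many,
  -- so the hyperfilter ignores the default value.
  let x : Fin n → α → ∀ N, M N := fun i j N =>
    if hi : (i : ℕ) < N then b N ⟨i, hi⟩ j else Classical.arbitrary _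
  let y : Set (Fin n) → β → ∀ N, M N := fun S j N => a N {k | ∃ i ∈ S, (i : ℕ) = k} j
  refine ⟨fun i j => ((x i j : ∀ N, M N) : P), fun S j => ((y S j : ∀ N, M N) : P), fun i S => ?_⟩
  have h1 := Ultraproduct.realize_formula_cast (u := U) φ (Sum.elim (x i) (y S))
  have h2 : (Sum.elim (fun j => ((x i j : ∀ N, M N) : P)) fun j => ((y S j : ∀ N, M N) : P)) =
      fun k => ((Sum.elim (x i) (y S) k : ∀ N, M N) : P) := by
    ext k; cases k <;> rfl
  unfold Holds
  refine (iff_of_eq (congrArg (fun g => φ.Realize (M := P) g) h2)).trans (h1.trans ?_)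
  have h3 : ∀ᶠ N in (U : Filter ℕ),
      ((φ.Realize fun k => Sum.elim (x i) (y S) k N) ↔ i ∈ S) := by
    have h4 : ∀ᶠ N in (U : Filter ℕ), (i : ℕ) < N :=
      Nat.hyperfilter_le_atTop (Filter.eventually_gt_atTop (i : ℕ))
    filter_upwards [h4] with N hN
    have h5 := hab N ⟨i, hN⟩ {k | ∃ i ∈ S, (i : ℕ) = k}
    have h6 : (fun k => Sum.elim (x i) (y S) k N) =
        Sum.elim (b N ⟨i, hN⟩) (a N {k | ∃ i ∈ S, (i : ℕ) = k}) := by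
      ext k; cases k <;> simp [x, y, hN]
    rw [h6]
    refine h5.trans ?_
    simp [Fin.val_inj]
  rw [Filter.eventually_congr h3, Filter.eventually_const]

end Compactness

/-! ### Formulas for votes, labelled samples and composition -/

section Formulas

variable {L : FirstOrder.Language.{u, v}} {α β γ δ : Type} {M : Type*} [L.Structure M]

theorem IsBooleanCombination.foldr_sup {S : Set (L.Formula γ)} (l : List (L.Formula γ))
    (h : ∀ φ ∈ l, IsBooleanCombination S φ) :
    IsBooleanCombination S (l.foldr (· ⊔ ·) ⊥) := by
  induction l with
  | nil => exact .bot
  | cons φ l ih =>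
    exact .imp _ _ (.imp _ _ (h φ (by simp)) .bot) (ih fun ψ hψ => h ψ (by simp [hψ]))

theorem IsBooleanCombination.foldr_inf {S : Set (L.Formula γ)} (l : List (L.Formula γ))
    (h : ∀ φ ∈ l, IsBooleanCombination S φ) :
    IsBooleanCombination S (l.foldr (· ⊓ ·) ⊤) := by
  induction l with
  | nil => exact .imp _ _ .bot .bot
  | cons φ l ih =>
    exact .imp _ _ (.imp _ _ (h φ (by simp))
      (.imp _ _ (ih fun ψ hψ => h ψ (by simp [hψ])) .bot)) .bot

theorem IsBooleanCombination.iSup {S : Set (L.Formula γ)} [Finite δ] {f : δ → L.Formula γ}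
    (h : ∀ i, IsBooleanCombination S (f i)) : IsBooleanCombination S (Formula.iSup f) :=
  .foldr_sup _ (by simpa using h)

theorem IsBooleanCombination.iInf {S : Set (L.Formula γ)} [Finite δ] {f : δ → L.Formula γ}
    (h : ∀ i, IsBooleanCombination S (f i)) : IsBooleanCombination S (Formula.iInf f) :=
  .foldr_inf _ (by simpa using h)

/-- The formula saying that more than half of the formulas `χ t` hold. -/
noncomputable def majority {m : ℕ} (χ : Fin m → L.Formula γ) : L.Formula γ :=
  Formula.iSup fun S : {S : Set (Fin m) // m < 2 * S.ncard} =>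
    Formula.iInf fun t : {t // t ∈ S.1} => χ t

theorem realize_majority {m : ℕ} (χ : Fin m → L.Formula γ) (v : γ → M) :
    (majority χ).Realize v ↔ m < 2 * {t | (χ t).Realize v}.ncard := by
  unfold majority
  simp only [Formula.realize_iSup, Formula.realize_iInf, Subtype.forall, Subtype.exists]
  constructor
  · rintro ⟨S, hS, h⟩
    have := Set.ncard_le_ncard (show S ⊆ {t | (χ t).Realize v} from h) (Set.toFinite _)
    omega
  · intro h
    exact ⟨_, h, fun t ht => ht⟩

theorem isBooleanCombination_majority {m : ℕ} (χ : Fin m → L.Formula γ) :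
    IsBooleanCombination (Set.range χ) (majority χ) :=
  .iSup fun _ => .iInf fun t => .of _ ⟨t, rfl⟩

/-- `x` realizes the labelled sample in which the `i`-th point is coded by three tuples: the
point itself and two tuples whose equality is its label. -/
noncomputable def consistentFormula [Finite β] (φ : L.Formula (α ⊕ β)) (s : ℕ) :
    L.Formula (α ⊕ ((Fin s × Fin 3) × β)) :=
  Formula.iInf fun i : Fin s =>
    (φ.relabel (Sum.map id fun j => ((i, (0 : Fin 3)), j))).iff
      (Formula.iInf fun j : β => Term.equal (Term.var (Sum.inr ((i, (1 : Fin 3)), j)))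
        (Term.var (Sum.inr ((i, (2 : Fin 3)), j))))

theorem holds_consistentFormula [Finite β] (φ : L.Formula (α ⊕ β)) {s : ℕ} (x : α → M)
    (c : (Fin s × Fin 3) × β → M) :
    Holds (consistentFormula φ s) x c ↔
      ∀ i, (Holds φ x (fun j => c ((i, 0), j)) ↔
        (fun j => c ((i, 1), j)) = fun j => c ((i, 2), j)) := by
  unfold Holds consistentFormula
  simp only [Formula.realize_iInf, Formula.realize_iff, Formula.realize_relabel,
    Formula.realize_equal, Term.realize_var, Sum.elim_inr, Sum.elim_comp_map, funext_iff]
  rfl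

/-- The formula saying that `φ(x, y)` holds for some `x` with `θ(z, x)`. -/
noncomputable def compFormula [Finite α] (θ : L.Formula (γ ⊕ α)) (φ : L.Formula (α ⊕ β)) :
    L.Formula (β ⊕ γ) :=
  Formula.iExs α (θ.relabel (Sum.map Sum.inr id) ⊓ φ.relabel (Sum.elim Sum.inr (Sum.inl ∘ Sum.inl)))

theorem holds_compFormula [Finite α] (θ : L.Formula (γ ⊕ α)) (φ : L.Formula (α ⊕ β)) (b : β → M)
    (c : γ → M) : Holds (compFormula θ φ) b c ↔ ∃ d : α → M, Holds θ c d ∧ Holds φ d b := by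
  unfold Holds compFormula
  rw [Formula.realize_iExs]
  refine exists_congr fun d => ?_
  rw [Formula.realize_inf, Formula.realize_relabel, Formula.realize_relabel]
  refine and_congr (iff_of_eq (congrArg _ ?_)) (iff_of_eq (congrArg _ ?_)) <;>
  · ext i; cases i <;> rfl

theorem holds_relabel_left (θ : L.Formula (δ ⊕ α)) (g : δ → γ) (c : γ → M) (d : α → M) :
    Holds (θ.relabel (Sum.map g id)) c d ↔ Holds θ (c ∘ g) d := by
  unfold Holds
  rw [Formula.realize_relabel, Sum.elim_comp_map, Function.comp_id]

end Formulas

/-- Over a finite `A` the type itself is finite, so finite satisfiability applies to all of it. -/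
theorem IsPhiType.exists_realization {L : FirstOrder.Language.{u, v}} {α β : Type} {M : Type*}
    [L.Structure M] {φ : L.Formula (α ⊕ β)} {A : Set (β → M)} {p : Set ((β → M) × Bool)}
    (hp : IsPhiType φ A p) (hA : A.Finite) :
    ∃ x : α → M, ∀ a ∈ A, (Holds φ x a ↔ (a, true) ∈ p) := by
  obtain ⟨x, hx⟩ := hp.consistent p subset_rfl
    ((hA.prod (Set.toFinite (Set.univ : Set Bool))).subset fun q hq => ⟨hp.fst_mem q hq, trivial⟩)
  refine ⟨x, fun a ha => ?_⟩
  rcases hp.complete a ha with h | h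
  · exact iff_of_true ((hx _ h).2 rfl) h
  · have h1 : ¬ Holds φ x a := fun h2 => by simpa using (hx _ h).1 h2
    exact iff_of_false h1 fun h2 => h1 ((hx _ h2).2 rfl)

end UDTFS

/-! ### Construction of `ψ` -/

theorem mainTheorem2 {L : FirstOrder.Language.{u, v}} (T : L.Theory)
    (hT : UDTFS.HasDefinableSkolemFunctions.{u, v, w} T)
    {α β : Type} [Finite α] [Finite β] (φ : L.Formula (α ⊕ β))
    (hφ : UDTFS.IsNIP.{u, v, w} T φ) :
    ∃ (k : ℕ) (ψ : L.Formula (β ⊕ (Fin k × β))),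
      UDTFS.UniformlyDefinesTypes.{u, v, w} T φ ψ ∧
      UDTFS.IsNIP.{u, v, w} T ψ ∧
      -- `ψ` is a majority vote of formulas `χ t (y, z) = φ(f t (z), y)`, with `f t` definable
      -- by `θ t`, and a Boolean combination of them
      ∃ (m : ℕ) (θ : Fin m → L.Formula ((Fin k × β) ⊕ α))
        (χ : Fin m → L.Formula (β ⊕ (Fin k × β))),
        (∀ t, UDTFS.DefinesFunction.{u, v, w} T (θ t)) ∧
        (∀ (t : Fin m) (M : T.ModelType.{u, v, max u v w}) (b : β → M) (c : Fin k × β → M)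
          (d : α → M), UDTFS.Holds (θ t) c d →
            (UDTFS.Holds (χ t) b c ↔ UDTFS.Holds φ d b)) ∧
        (∀ (M : T.ModelType.{u, v, max u v w}) (b : β → M) (c : Fin k × β → M),
          UDTFS.Holds ψ b c ↔ m < 2 * {t : Fin m | UDTFS.Holds (χ t) b c}.ncard) ∧
        UDTFS.IsBooleanCombination (Set.range χ) ψ := by
  classical
  -- Skolem functions need nonempty parameter tuples. For empty `y`, `M^y` is a single point, so no
  -- `A` has two elements and the vote with `m = 0` suffices.
  rcases isEmpty_or_nonempty β with hβ | hβ
  · refine ⟨0, ⊥, fun M A _ hA => ?_, fun M => ⟨1, fun A hA hs => ?_⟩, 0, Fin.elim0, Fin.elim0,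
      fun t => t.elim0, fun t => t.elim0, fun M b c => ?_, .bot⟩
    · have := Set.ncard_le_one_of_subsingleton A
      omega
    · obtain ⟨a, ha⟩ : A.Nonempty := Finset.card_pos.1 (by omega)
      obtain ⟨_, ⟨c, rfl⟩, hc⟩ := hs A subset_rfl
      exact (hc.symm.subset ha).1
    · simp [UDTFS.Holds, Set.eq_empty_of_isEmpty]
  obtain ⟨n, hn⟩ := hφ.exists_uniform
  -- The exponent `2 ^ n`, required for the dual family, also serves for the family itself.
  have hgrowth : ∀ M : T.ModelType.{u, v, max u v w}, UDTFS.PolyGrowth (2 ^ n)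
      fun (b : α → M) (a : β → M) => UDTFS.Holds φ b a := fun M =>
    UDTFS.polyGrowth_of_not_hasPattern fun h => hn M (h.mono Nat.lt_two_pow_self.le)
  have hgrowth' : ∀ M : T.ModelType.{u, v, max u v w}, UDTFS.PolyGrowth (2 ^ n)
      fun (a : β → M) (b : α → M) => UDTFS.Holds φ b a := fun M =>
    UDTFS.polyGrowth_of_not_hasPattern fun h => hn M h.of_swap
  obtain ⟨s, m, hs, hm, hcomp⟩ := UDTFS.exists_compression_size (2 ^ n)
  have : Nonempty (Fin s) := ⟨⟨0, hs⟩⟩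
  obtain ⟨θ₀, hθ₀, hskolem⟩ := hT α ((Fin s × Fin 3) × β) (UDTFS.consistentFormula φ s)
  -- The parameters of `ψ` are `m` samples of `s` points, three tuples per point.
  let e : Fin m × Fin s × Fin 3 ≃ Fin (m * (s * 3)) :=
    Fintype.equivFinOfCardEq (by simp)
  let g : Fin m → (Fin s × Fin 3) × β → Fin (m * (s * 3)) × β := fun t p => (e (t, p.1), p.2)
  let θ : Fin m → L.Formula ((Fin (m * (s * 3)) × β) ⊕ α) := fun t =>
    θ₀.relabel (Sum.map (g t) id)
  let χ : Fin m → L.Formula (β ⊕ (Fin (m * (s * 3)) × β)) := fun t =>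
    UDTFS.compFormula (θ t) φ
  have hθ : ∀ t, UDTFS.DefinesFunction.{u, v, w} T (θ t) := fun t M c => by
    simpa only [θ, UDTFS.holds_relabel_left] using hθ₀ M (c ∘ g t)
  have hχ : ∀ (t : Fin m) (M : T.ModelType.{u, v, max u v w}) (b : β → M)
      (c : Fin (m * (s * 3)) × β → M) (d : α → M), UDTFS.Holds (θ t) c d →
        (UDTFS.Holds (χ t) b c ↔ UDTFS.Holds φ d b) := by
    intro t M b c d hd
    rw [UDTFS.holds_compFormula]
    refine ⟨?_, fun h => ⟨d, hd, h⟩⟩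
    rintro ⟨d', hd', h⟩
    rwa [(hθ t M c).unique hd hd']
  have hψ : ∀ (M : T.ModelType.{u, v, max u v w}) (b : β → M) (c : Fin (m * (s * 3)) × β → M),
      UDTFS.Holds (UDTFS.majority χ) b c ↔ m < 2 * {t : Fin m | UDTFS.Holds (χ t) b c}.ncard :=
    fun M b c => UDTFS.realize_majority χ _
  refine ⟨m * (s * 3), UDTFS.majority χ, ?_, ?_, m, θ, χ, hθ, hχ, hψ,
    UDTFS.isBooleanCombination_majority χ⟩
  · intro M A hA hA₂ p hp
    obtain ⟨x₀, hx₀⟩ := hp.exists_realization hA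
    obtain ⟨a₀, ha₀, a₁, ha₁, hne⟩ := (Set.one_lt_ncard hA).1 hA₂
    -- The label "true" is coded by the pair `(a₀, a₀)` and "false" by `(a₀, a₁)`, so that all
    -- parameters lie in `A`.
    let code : (Fin s → A) → Fin s × Fin 3 → β → M := fun Z q =>
      if q.2 = 0 then Z q.1 else
        if q.2 = 1 then a₀ else if UDTFS.Holds φ x₀ (Z q.1) then a₀ else a₁
    have hcode : ∀ Z q, code Z q ∈ A := by
      intro Z q
      simp only [code]
      split_ifs
      exacts [(Z q.1).2, ha₀, ha₀, ha₁]
    choose f hf _ using hθ₀ M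
    have hcons : ∀ (Z : Fin s → A) (x : α → M),
        UDTFS.Holds (UDTFS.consistentFormula φ s) x (Function.uncurry (code Z)) ↔
          ∀ i, (UDTFS.Holds φ x (Z i) ↔ UDTFS.Holds φ x₀ (Z i)) := by
      intro Z x
      rw [UDTFS.holds_consistentFormula]
      refine forall_congr' fun i => iff_congr ?_ ?_
      · simp [code, Function.uncurry]
      · simp only [code, Function.uncurry]
        by_cases h : UDTFS.Holds φ x₀ (Z i) <;> simp [h, hne]
    obtain ⟨Z, hZ⟩ := hcomp (hgrowth M) (hgrowth' M) A hA ⟨a₀, ha₀⟩ x₀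
      (fun Z => f (Function.uncurry (code Z)))
      (fun Z => (hcons Z _).1 (hskolem M _ _ (hf _) ⟨x₀, (hcons Z x₀).2 fun _ => Iff.rfl⟩))
    refine ⟨fun i => code (Z (e.symm i).1) (e.symm i).2, fun i => hcode _ _, fun b hb => ?_⟩
    rw [← hx₀ b hb, hZ b hb, hψ]
    have hset : ∀ t, UDTFS.Holds (χ t) b
        (Function.uncurry fun i => code (Z (e.symm i).1) (e.symm i).2) ↔
        UDTFS.Holds φ (f (Function.uncurry (code (Z t)))) b := by
      intro t
      refine hχ t M b _ _ ?_
      simp only [θ, UDTFS.holds_relabel_left]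
      convert hf (Function.uncurry (code (Z t))) using 1
      ext ⟨q, j⟩
      simp [g, Function.uncurry]
    simp only [hset]
  · rw [UDTFS.isNIP_iff]
    intro M
    choose f hf _ using fun t => hθ t M
    obtain ⟨N, hN⟩ := (hgrowth' M).exists_not_hasPattern_comb f fun S => m < 2 * S.ncard
    refine ⟨N, fun h => hN ?_⟩
    simpa only [hψ, hχ _ M _ _ _ (hf _ _)] using h
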